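/- **Setting.** All Hilbert spaces are finite-dimensional and nonzero, with fixed orthonormal bases. There are finitely many local agents $A_i$ with input and output message spaces $\mathcal H^{A_i^I},\mathcal H^{A_i^O}$, a global past with space $\mathcal H^P$ and a global future with space $\mathcal H^F$. Let $\mathcal T$ be a finite partially ordered set of positions. Each agent has input positions $\mathcal T_i^I\subseteq\mathcal T$, output positions $\mathcal T_i^O\subseteq\mathcal T$ and a bijection $\mathcal O_i:\mathcal T_i^I\to\mathcal T_i^O$ with $\mathcal O_i(t)>t$. The global past sends exactly one message, at a least element $t_P$ of $\mathcal T$; the global future receives exactly one message, at a greatest element $t_F$. The wire of $A_i$ at a position $t$ has the space $\mathcal H^{\bar A_i^{I/O}}=\mathbb C|\Omega\rangle\oplus\mathcal H^{A_i^{I/O}}$ (vacuum or one message). A *local operation* of $A_i$ is a map $\mathcal M_i=\bigotimes_{t\in\mathcal T_i^I}\mathcal M_i^t$, where each $\mathcal M_i^t$ is a completely positive trace-nonincreasing map from the operators on the input wire at $t$ to those on the output wire at $\mathcal O_i(t)$, with $\mathcal M_i^t(|\Omega\rangle\langle\Omega|)=|\Omega\rangle\langle\Omega|$ and mapping operators on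 $\mathcal H^{A_i^I}$ to operators on $\mathcal H^{A_i^O}$. We write $M_i$ for its Choi matrix and $*$ for the link product. A *process box* $\Phi$ on $\mathcal T$ is a completely positive trace-preserving map from the operators on $\mathcal H^P\otimes\bigotimes_{i,\,t\in\mathcal T_i^O}\mathcal H^{\bar A_i^O}$ to the operators on $\bigotimes_{i,\,t\in\mathcal T_i^I}\mathcal H^{\bar A_i^I}\otimes\mathcal H^F$ such that 1. (causality) there is a causality function $\chi$ on the cuts (lower sets) of $\mathcal T$ such that for every cut $\mathcal C$ the output of $\Phi$ at the positions in $\mathcal C$ is determined by the restriction of the input to the positions in $\chi(\mathcal C)$. Here a causality function satisfies $\chi(\mathcal C\cup\mathcal D)=\chi(\mathcal C)\cup\chi(\mathcal D)$; $\mathcal C\subseteq\mathcal D\Rightarrow\chi(\mathcal C)\subseteq\chi(\mathcal D)$; $\chi(\mathcal C)\subsetneq\mathcal C$ for bounded $\mathcal C\neq\emptyset$; and for bounded $\mathcal C$ and $t\in\mathcal C$ there is $n$ with $t\notin\chi^n(\mathcal C)$; 2. in composition with arbitrary local operations, each agent receives exactly one message in the whole run: every branch (obtained by projecting the agents' wires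 onto a fixed pattern of vacuum/non-vacuum) in which some agent does not receive exactly one message vanishes. $\Phi$ is *of simple form* if $\mathcal T=\{1,\dots,m\}$ with $m$ even, $t_P=1$, $t_F=m$, and for all agents $\mathcal T_i^I=\{2,4,\dots,m-2\}$, $\mathcal T_i^O=\{3,5,\dots,m-1\}$ and $\mathcal O_i(t)=t+1$. Process boxes $\Phi$ and $\Phi'$ are *operationally equivalent* if there are a one-to-one correspondence $A_i\leftrightarrow A_i'$ of their agents, maps $\mathcal M_i\mapsto\mathcal M_i'$ from the local operations of each $A_i$ to those of $A'_i$, and unitaries $U:\mathcal H^P\to\mathcal H^{P'}$, $V:\mathcal H^F\to\mathcal H^{F'}$ such that for all choices of local operations $$\Big(\bigotimes_i M'_i\Big)*\Phi'=(U\otimes V)\Big[\Big(\bigotimes_i M_i\Big)*\Phi\Big](U\otimes V)^\dagger .$$ **Lemma.** Let $\Phi$ be a process box of simple form with $\mathcal T=\{1,\dots,m\}$. Then there are $m'$ and a process box $\Phi'$ of simple form with $\mathcal T'=\{1,\dots,m'\}$, with the same agents, message spaces, global past and global future spaces, such that $\Phi$ is operationally equivalent to $\Phi'$ and at every $t\in\mathcal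 T'$ * $\Phi'$ sends at most one message (to all agents and the global future together), whatever input it receives; * $\Phi'$ receives at most one message (from all agents and the global past together) in composition with any local operations. -/

import Mathlib

open Matrix
open scoped Kronecker ComplexOrder

universe u v

noncomputable section

/-! ### Linear maps between matrix algebras -/

/-- The amplification `id ⊗ Φ` of a linear map `Φ` by a `k`-dimensional system. -/
def amplify {X Y : Type*} (Φ : Matrix X X ℂ →ₗ[ℂ] Matrix Y Y ℂ) (k : ℕ)
    (ρ : Matrix (Fin k × X) (Fin k × X) ℂ) : Matrix (Fin k × Y) (Fin k × Y) ℂ :=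
  Matrix.of fun u v => Φ (Matrix.of fun x x' => ρ (u.1, x) (v.1, x')) u.2 v.2

/-- Complete positivity: every amplification preserves positive semidefiniteness. -/
def IsCompletelyPositive {X Y : Type*} (Φ : Matrix X X ℂ →ₗ[ℂ] Matrix Y Y ℂ) : Prop :=
  ∀ (k : ℕ) (ρ : Matrix (Fin k × X) (Fin k × X) ℂ), ρ.PosSemidef → (amplify Φ k ρ).PosSemidef

def IsTracePreserving {X Y : Type*} [Fintype X] [Fintype Y]
    (Φ : Matrix X X ℂ →ₗ[ℂ] Matrix Y Y ℂ) : Prop :=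
  ∀ ρ, (Φ ρ).trace = ρ.trace

def IsTraceNonincreasing {X Y : Type*} [Fintype X] [Fintype Y]
    (Φ : Matrix X X ℂ →ₗ[ℂ] Matrix Y Y ℂ) : Prop :=
  ∀ ρ, ρ.PosSemidef → (Φ ρ).trace.re ≤ ρ.trace.re

/-- The Choi matrix `∑ |x⟩⟨x'| ⊗ Φ(|x⟩⟨x'|)`. -/
def choi {X Y : Type*} [DecidableEq X] (Φ : Matrix X X ℂ →ₗ[ℂ] Matrix Y Y ℂ) :
    Matrix (X × Y) (X × Y) ℂ :=
  Matrix.of fun u v => Φ (Matrix.single u.1 v.1 1) u.2 v.2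

/-- The link product `A * B = Tr_Y ((Aᵀ ⊗ 1) B) = ∑_{y,y'} A_{yy'} B_{yy'}` of an operator `A` on
the shared space `Y` and an operator `B` on `Y ⊗ Z`. -/
def linkProduct {Y Z : Type*} [Fintype Y] (A : Matrix Y Y ℂ) (B : Matrix (Y × Z) (Y × Z) ℂ) :
    Matrix Z Z ℂ :=
  Matrix.of fun z z' => ∑ y, ∑ y', A y y' * B (y, z) (y', z')

open Classical in
/-- Partial trace of an operator on `⊗_w B w`: the wires in `K` are kept, the others traced out. -/
def partialTrace {W : Type*} [Fintype W] [DecidableEq W] {B : W → Type*} [∀ w, Fintype (B w)]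
    (K : Set W) (ρ : Matrix (∀ w, B w) (∀ w, B w) ℂ) :
    Matrix (∀ w : {w // w ∈ K}, B w) (∀ w : {w // w ∈ K}, B w) ℂ :=
  Matrix.of fun x y => ∑ z : (∀ w : {w // w ∉ K}, B w),
    ρ ((Equiv.piEquivPiSubtypeProd (· ∈ K) B).symm (x, z))
      ((Equiv.piEquivPiSubtypeProd (· ∈ K) B).symm (y, z))

/-! ### Causality functions -/

/-- Cuts of the partially ordered set `T` are its lower sets. A cut is bounded if it lies below
some point of `T`. -/
def IsBoundedCut {T : Type*} [PartialOrder T] (C : LowerSet T) : Prop :=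
  ∃ t : T, C ≤ LowerSet.Iic t

structure IsCausalityFunction {T : Type*} [PartialOrder T] (χ : LowerSet T → LowerSet T) :
    Prop where
  union : ∀ C D, χ (C ⊔ D) = χ C ⊔ χ D
  mono : ∀ C D, C ≤ D → χ C ≤ χ D
  strict : ∀ C, IsBoundedCut C → C ≠ ⊥ → χ C < C
  exhaust : ∀ C, IsBoundedCut C → ∀ t ∈ C, ∃ n : ℕ, t ∉ χ^[n] C

/-! ### Agents and positions -/

/-- Finitely many local agents `A_i` with (nonzero, finite-dimensional) message spaces for their
inputs and outputs, together with the space of the global past and that of the global future. A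
space is given by the index type of its fixed orthonormal basis. -/
structure AgentSpaces where
  Agent : Type u
  Inp : Agent → Type u
  Out : Agent → Type u
  Past : Type u
  Future : Type u
  [agentFintype : Fintype Agent]
  [agentDecEq : DecidableEq Agent]
  [inpFintype : ∀ i, Fintype (Inp i)]
  [inpDecEq : ∀ i, DecidableEq (Inp i)]
  [inpNonempty : ∀ i, Nonempty (Inp i)]
  [outFintype : ∀ i, Fintype (Out i)]
  [outDecEq : ∀ i, DecidableEq (Out i)]
  [outNonempty : ∀ i, Nonempty (Out i)]
  [pastFintype : Fintype Past]
  [pastDecEq : DecidableEq Past]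
  [pastNonempty : Nonempty Past]
  [futureFintype : Fintype Future]
  [futureDecEq : DecidableEq Future]
  [futureNonempty : Nonempty Future]

attribute [instance] AgentSpaces.agentFintype AgentSpaces.agentDecEq AgentSpaces.inpFintype
  AgentSpaces.inpDecEq AgentSpaces.inpNonempty AgentSpaces.outFintype AgentSpaces.outDecEq
  AgentSpaces.outNonempty AgentSpaces.pastFintype AgentSpaces.pastDecEq AgentSpaces.pastNonempty
  AgentSpaces.futureFintype AgentSpaces.futureDecEq AgentSpaces.futureNonempty

/-- The positions, in the partially ordered set `T`, at which the agents act: the input positions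
`𝒯ᴵ_i`, the output positions `𝒯ᴼ_i`, the bijection `𝒪_i : 𝒯ᴵ_i → 𝒯ᴼ_i` with `𝒪_i(t) > t`, the
position at which the global past sends and the one at which the global future receives. -/
structure Positions (A : AgentSpaces.{u}) (T : Type v) [PartialOrder T] where
  inp : A.Agent → Finset T
  out : A.Agent → Finset T
  resp : ∀ i, inp i ≃ out i
  lt_resp : ∀ i (t : inp i), (t : T) < (resp i t : T)
  past : T
  past_le : ∀ t, past ≤ t
  future : T
  le_future : ∀ t, t ≤ future

namespace Positions

variable {A : AgentSpaces.{u}} {T : Type v} [PartialOrder T] [DecidableEq T]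

/-- The wires (one for each agent and each of its input positions) from the process box to the
agents. -/
abbrev InWire (L : Positions A T) : Type (max u v) := Σ i : A.Agent, {t // t ∈ L.inp i}

/-- The wires from the agents to the process box. -/
abbrev OutWire (L : Positions A T) : Type (max u v) := Σ i : A.Agent, {t // t ∈ L.out i}

/-- The wire on which an agent answers to the input on the wire `w`. -/
def answer (L : Positions A T) (w : L.InWire) : L.OutWire := ⟨w.1, L.resp w.1 w.2⟩

/-- Basis of all input wires of the agents, `⊗_i ⊗_{t ∈ 𝒯ᴵ_i} (ℂ|Ω⟩ ⊕ ℋ^{Aᴵ_i})`. The vacuum `Ω`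
is `none`, one message in the basis state `a` is `some a`. -/
abbrev AgentIn (L : Positions A T) : Type (max u v) := ∀ w : L.InWire, Option (A.Inp w.1)

/-- Basis of all output wires of the agents, `⊗_i ⊗_{t ∈ 𝒯ᴼ_i} (ℂ|Ω⟩ ⊕ ℋ^{Aᴼ_i})`. -/
abbrev AgentOut (L : Positions A T) : Type (max u v) := ∀ w : L.OutWire, Option (A.Out w.1)

/-- The input wires of the process box: `none` is the wire from the global past, the others are
the output wires of the agents. The global past always sends exactly one message. -/
def BoxInBasis (L : Positions A T) : Option L.OutWire → Type u
  | none => A.Past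
  | some w => Option (A.Out w.1)

/-- The output wires of the process box: `none` is the wire to the global future, the others are
the input wires of the agents. -/
def BoxOutBasis (L : Positions A T) : Option L.InWire → Type u
  | none => A.Future
  | some w => Option (A.Inp w.1)

instance (L : Positions A T) : ∀ w, Fintype (L.BoxInBasis w)
  | none => inferInstanceAs (Fintype A.Past)
  | some w => inferInstanceAs (Fintype (Option (A.Out w.1)))

instance (L : Positions A T) : ∀ w, DecidableEq (L.BoxInBasis w)
  | none => inferInstanceAs (DecidableEq A.Past)
  | some w => inferInstanceAs (DecidableEq (Option (A.Out w.1)))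

instance (L : Positions A T) : ∀ w, Fintype (L.BoxOutBasis w)
  | none => inferInstanceAs (Fintype A.Future)
  | some w => inferInstanceAs (Fintype (Option (A.Inp w.1)))

instance (L : Positions A T) : ∀ w, DecidableEq (L.BoxOutBasis w)
  | none => inferInstanceAs (DecidableEq A.Future)
  | some w => inferInstanceAs (DecidableEq (Option (A.Inp w.1)))

/-- Basis of the total input space of the process box. -/
abbrev BoxIn (L : Positions A T) : Type (max u v) := ∀ w, L.BoxInBasis w

/-- Basis of the total output space of the process box. -/
abbrev BoxOut (L : Positions A T) : Type (max u v) := ∀ w, L.BoxOutBasis w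

/-- The basis state of the box input made of a state of the global past and one of the agents'
output wires. -/
def boxIn (L : Positions A T) (p : A.Past) (b : L.AgentOut) : L.BoxIn
  | none => p
  | some w => b w

/-- The basis state of the box output made of a state of the agents' input wires and one of the
global future. -/
def boxOut (L : Positions A T) (a : L.AgentIn) (f : A.Future) : L.BoxOut
  | none => f
  | some w => a w

/-- The input wires of the process box with position in `C`. -/
def boxInWires (L : Positions A T) (C : LowerSet T) : Set (Option L.OutWire) :=
  {w | w.elim L.past (fun w => (w.2 : T)) ∈ C}

/-- The output wires of the process box with position in `C`. -/
def boxOutWires (L : Positions A T) (C : LowerSet T) : Set (Option L.InWire) :=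
  {w | w.elim L.future (fun w => (w.2 : T)) ∈ C}

end Positions

/-! ### Local operations -/

/-- A local operation (for one fixed measurement outcome) of the agent `i`. By the operation-space
restriction it is a tensor product over the input positions `t` of maps from the input wire at `t`
to the output wire at `𝒪_i(t)`. Local order: the vacuum is mapped to the vacuum. Active agents: a
message is mapped to a message. -/
structure LocalOperation {A : AgentSpaces.{u}} {T : Type v} [PartialOrder T]
    (L : Positions A T) (i : A.Agent) where
  op : {t // t ∈ L.inp i} → (Matrix (Option (A.Inp i)) (Option (A.Inp i)) ℂ →ₗ[ℂ]
    Matrix (Option (A.Out i)) (Option (A.Out i)) ℂ)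
  completelyPositive : ∀ t, IsCompletelyPositive (op t)
  traceNonincreasing : ∀ t, IsTraceNonincreasing (op t)
  localOrder : ∀ t, op t (Matrix.single none none 1) = Matrix.single none none 1
  active : ∀ t a a' y, op t (Matrix.single (some a) (some a') 1) none y = 0 ∧
    op t (Matrix.single (some a) (some a') 1) y none = 0

namespace Positions

variable {A : AgentSpaces.{u}} {T : Type v} [PartialOrder T] [DecidableEq T]

/-- The Choi matrix `⊗_i M_{A_i}` of the product `⊗_i ⊗_t M_{A_i}^t` of the local operations. -/
def agentsChoi (L : Positions A T) (M : ∀ i, LocalOperation L i) :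
    Matrix (L.AgentIn × L.AgentOut) (L.AgentIn × L.AgentOut) ℂ :=
  Matrix.of fun u v => ∏ w : L.InWire,
    choi ((M w.1).op w.2) (u.1 w, u.2 (L.answer w)) (v.1 w, v.2 (L.answer w))

/-- The Choi matrix of a map from the box input to the box output, regarded as an operator on the
wires of the agents (the spaces shared with the agents) and on the global past and future. -/
def boxChoi (L : Positions A T)
    (Φ : Matrix L.BoxIn L.BoxIn ℂ →ₗ[ℂ] Matrix L.BoxOut L.BoxOut ℂ) :
    Matrix ((L.AgentIn × L.AgentOut) × (A.Past × A.Future))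
      ((L.AgentIn × L.AgentOut) × (A.Past × A.Future)) ℂ :=
  Matrix.of fun u v => choi Φ (L.boxIn u.2.1 u.1.2, L.boxOut u.1.1 u.2.2)
    (L.boxIn v.2.1 v.1.2, L.boxOut v.1.1 v.2.2)

/-- `⊗_i M_{A_i} * Φ`: the Choi matrix of the map from the global past to the global future
obtained by composing the box with the local operations. -/
def compose (L : Positions A T)
    (Φ : Matrix L.BoxIn L.BoxIn ℂ →ₗ[ℂ] Matrix L.BoxOut L.BoxOut ℂ)
    (M : ∀ i, LocalOperation L i) : Matrix (A.Past × A.Future) (A.Past × A.Future) ℂ :=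
  linkProduct (L.agentsChoi M) (L.boxChoi Φ)

/-- The state `y` of the agents' wires has messages exactly on the input wires in `s` and on the
output wires in `r`. -/
def HasPattern (L : Positions A T) (s : L.InWire → Bool) (r : L.OutWire → Bool)
    (y : L.AgentIn × L.AgentOut) : Prop :=
  (∀ w, (y.1 w).isSome = s w) ∧ (∀ w, (y.2 w).isSome = r w)

instance (L : Positions A T) (s : L.InWire → Bool) (r : L.OutWire → Bool)
    (y : L.AgentIn × L.AgentOut) : Decidable (L.HasPattern s r y) :=
  inferInstanceAs (Decidable (_ ∧ _))

/-- The branch of the composition `⊗_i M_{A_i} * Φ` in which messages are found exactly on the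
input wires in `s` and the output wires in `r` of the agents: the operations of the agents are
preceded and followed by the projectors onto this message pattern. -/
def composeBranch (L : Positions A T)
    (Φ : Matrix L.BoxIn L.BoxIn ℂ →ₗ[ℂ] Matrix L.BoxOut L.BoxOut ℂ)
    (M : ∀ i, LocalOperation L i) (s : L.InWire → Bool) (r : L.OutWire → Bool) :
    Matrix (A.Past × A.Future) (A.Past × A.Future) ℂ :=
  linkProduct
    (Matrix.of fun y y' => if L.HasPattern s r y ∧ L.HasPattern s r y' then
      L.agentsChoi M y y' else 0)
    (L.boxChoi Φ)

end Positions

/-! ### Process boxes -/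

/-- A process box with set of positions `T`. As `T` has a greatest element, it is a bounded cut
of itself, and the consistent family `Φ^C` of maps of a causal box is given by the total map
`Φ = Φ^T` through `Φ^C = Tr_{T \ C} ∘ Φ`.

* `causal`: the output at the positions in the cut `C` is determined by the input at the positions
  in `χ C`, for some causality function `χ`.
* `exactlyOne`: the box can be composed with all agents that obey the wire-space restriction (each
  agent receives at most one message in the whole run), and agents are fully active (each receives
  a message with probability one): every branch in which the number of messages received by some
  agent is not one vanishes, whatever the local operations are. -/
structure ProcessBox (A : AgentSpaces.{u}) (T : Type v) [PartialOrder T] [Fintype T]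
    [DecidableEq T] where
  pos : Positions A T
  map : Matrix pos.BoxIn pos.BoxIn ℂ →ₗ[ℂ] Matrix pos.BoxOut pos.BoxOut ℂ
  completelyPositive : IsCompletelyPositive map
  tracePreserving : IsTracePreserving map
  causal : ∃ χ : LowerSet T → LowerSet T, IsCausalityFunction χ ∧
    ∀ (C : LowerSet T) (ρ ρ' : Matrix pos.BoxIn pos.BoxIn ℂ),
      partialTrace (pos.boxInWires (χ C)) ρ = partialTrace (pos.boxInWires (χ C)) ρ' →
      partialTrace (pos.boxOutWires C) (map ρ) = partialTrace (pos.boxOutWires C) (map ρ')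
  exactlyOne : ∀ (M : ∀ i, LocalOperation pos i) (s : pos.InWire → Bool)
    (r : pos.OutWire → Bool),
    (∃ i, (Finset.univ.filter fun t : {t // t ∈ pos.inp i} => s ⟨i, t⟩ = true).card ≠ 1) →
    pos.composeBranch map M s r = 0

namespace ProcessBox

variable {A : AgentSpaces.{u}} {T : Type v} [PartialOrder T] [Fintype T] [DecidableEq T]

/-- `⊗_i M_{A_i} * Φ`. -/
def compose (Φ : ProcessBox A T) (M : ∀ i, LocalOperation Φ.pos i) :
    Matrix (A.Past × A.Future) (A.Past × A.Future) ℂ :=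
  Φ.pos.compose Φ.map M

/-- Whatever the box receives, it sends at most one message at each position; the message to the
global future is counted. -/
def SendsAtMostOne (Φ : ProcessBox A T) : Prop :=
  ∀ (ρ : Matrix Φ.pos.BoxIn Φ.pos.BoxIn ℂ) (a : Φ.pos.AgentIn) (f : A.Future) (t : T),
    1 < (Finset.univ.filter fun w : Φ.pos.InWire => (w.2 : T) = t ∧ (a w).isSome = true).card
      + (if t = Φ.pos.future then 1 else 0) →
    Φ.map ρ (Φ.pos.boxOut a f) (Φ.pos.boxOut a f) = 0

/-- In composition with any local operations, the box receives at most one message at each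
position; the message from the global past is counted. -/
def ReceivesAtMostOne (Φ : ProcessBox A T) : Prop :=
  ∀ (M : ∀ i, LocalOperation Φ.pos i) (s : Φ.pos.InWire → Bool) (r : Φ.pos.OutWire → Bool) (t : T),
    1 < (Finset.univ.filter fun w : Φ.pos.OutWire => (w.2 : T) = t ∧ r w = true).card
      + (if t = Φ.pos.past then 1 else 0) →
    Φ.pos.composeBranch Φ.map M s r = 0

/-- Operational equivalence: a one-to-one correspondence of the agents and maps from the local
operations of the agents of `Φ` to those of the corresponding agents of `Φ'` such that the
compositions with corresponding local operations agree, up to unitaries between the global pasts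
and between the global futures. -/
def OperationallyEquivalent {A' : AgentSpaces.{u}} {T' : Type v} [PartialOrder T'] [Fintype T']
    [DecidableEq T'] (Φ : ProcessBox A T) (Φ' : ProcessBox A' T') : Prop :=
  ∃ (e : A'.Agent ≃ A.Agent)
    (f : ∀ j : A'.Agent, LocalOperation Φ.pos (e j) → LocalOperation Φ'.pos j)
    (U : Matrix A'.Past A.Past ℂ) (V : Matrix A'.Future A.Future ℂ),
    (Uᴴ * U = 1 ∧ U * Uᴴ = 1) ∧ (Vᴴ * V = 1 ∧ V * Vᴴ = 1) ∧
    ∀ M : (∀ i, LocalOperation Φ.pos i),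
      Φ'.compose (fun j => f j (M (e j))) = (U ⊗ₖ V) * Φ.compose M * (U ⊗ₖ V)ᴴ

end ProcessBox

/-- The set of positions `{1, …, m}`. -/
abbrev Steps (m : ℕ) : Type := {t : ℕ // t ∈ Finset.Icc 1 m}

/-- The simplified form of the positions: `𝒯 = {1, …, m}`, all agents have the input positions
`{2, 4, …}`, the output positions `{3, 5, …}` and `𝒪(t) = t + 1`; the global past (the agent with
trivial input) sends at `1` and the global future (which has no output) receives at the last input
position `m`, which is reserved for it. -/
def ProcessBox.HasSimpleForm {A : AgentSpaces.{u}} {m : ℕ} (Φ : ProcessBox A (Steps m)) : Prop :=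
  Even m ∧ (Φ.pos.past : ℕ) = 1 ∧ (Φ.pos.future : ℕ) = m ∧
  ∀ i, (∀ t : Steps m, t ∈ Φ.pos.inp i ↔ Even (t : ℕ) ∧ (t : ℕ) < m) ∧
    (∀ t : Steps m, t ∈ Φ.pos.out i ↔ Odd (t : ℕ) ∧ 1 < (t : ℕ)) ∧
    ∀ t, ((Φ.pos.resp i t : Steps m) : ℕ) = (t : Steps m) + 1

end

/-!
Every wire from the box to an agent gets a step of its own. Sort these wires along a linear
extension of their positions and let the `b`-th of them carry messages at the steps `2b + 2`
(input) and `2b + 3` (answer). Among the many wires of the simple form at these steps all but one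
are unused: the new box discards what it receives on them and sends the vacuum. Since agents answer
the vacuum by the vacuum, an unused wire contributes the factor `1` to the composition with local
operations, which is therefore unchanged.

Causality survives because an answer comes immediately after its input: if an answer precedes an
input in the original order, then so does the input it belongs to, and the whole pair of steps of
the former is placed before the pair of the latter. Sending every cut to the set of positions
strictly below one of its elements is the largest causality function, so that only the strict
order of the positions matters.
-/

/-! ### Partial traces along maps of basis states -/

section PushTrace

variable {U X Y : Type*} [Fintype U]

open Classical in
/-- The partial trace along a map `π` of basis states: the entry at `x, y` is the sum of the
`ρ u v` with `π u = x`, `π v = y` and `R u v`. For a tensor product, `π` remembers the state of the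
wires that are kept and `R` says that the other wires agree. -/
noncomputable def pushTrace (π : U → X) (R : U → U → Prop) : Matrix U U ℂ →ₗ[ℂ] Matrix X X ℂ where
  toFun ρ := Matrix.of fun x y => ∑ u, ∑ v, if π u = x ∧ π v = y ∧ R u v then ρ u v else 0
  map_add' ρ σ := by
    ext x y
    simp only [Matrix.of_apply, Matrix.add_apply, ← Finset.sum_add_distrib, ite_add_ite, add_zero]
  map_smul' c ρ := by
    ext x y
    simp only [Matrix.of_apply, Matrix.smul_apply, smul_eq_mul, Finset.mul_sum, mul_ite, mul_zero,
      RingHom.id_apply]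

open Classical in
theorem pushTrace_apply (π : U → X) (R : U → U → Prop) (ρ : Matrix U U ℂ) (x y : X) :
    pushTrace π R ρ x y = ∑ u, ∑ v, if π u = x ∧ π v = y ∧ R u v then ρ u v else 0 := rfl

open Classical in
theorem pushTrace_apply_of_injective {π : U → X} (hπ : Function.Injective π) (R : U → U → Prop)
    (ρ : Matrix U U ℂ) (u v : U) :
    pushTrace π R ρ (π u) (π v) = if R u v then ρ u v else 0 := by
  simp [pushTrace_apply, hπ.eq_iff, ite_and]

theorem mem_range_of_pushTrace_apply_ne_zero {π : U → X} {R : U → U → Prop} {ρ : Matrix U U ℂ}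
    {x y : X} (h : pushTrace π R ρ x y ≠ 0) : x ∈ Set.range π ∧ y ∈ Set.range π := by
  classical
  obtain ⟨u, -, hu⟩ := Finset.exists_ne_zero_of_sum_ne_zero h
  obtain ⟨v, -, hv⟩ := Finset.exists_ne_zero_of_sum_ne_zero hu
  obtain ⟨hx, hy, -⟩ := (ite_ne_right_iff.1 hv).1
  exact ⟨⟨u, hx⟩, ⟨v, hy⟩⟩

open Classical in
theorem pushTrace_single [DecidableEq U] [DecidableEq X] (π : U → X) (R : U → U → Prop) (u v : U) :
    pushTrace π R (Matrix.single u v 1) =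
      if R u v then Matrix.single (π u) (π v) 1 else 0 := by
  ext x y
  rw [pushTrace_apply, Fintype.sum_eq_single u fun w hw => by simp [hw.symm],
    Fintype.sum_eq_single v fun w hw => by simp [hw.symm]]
  by_cases hR : R u v <;> simp [hR, Matrix.single_apply]

open Classical in
theorem sum_mul_pushTrace [Fintype X] (π : U → X) (R : U → U → Prop) (ρ : Matrix U U ℂ)
    (g : X → X → ℂ) :
    ∑ x, ∑ y, g x y * pushTrace π R ρ x y =
      ∑ u, ∑ v, if R u v then g (π u) (π v) * ρ u v else 0 := by
  have hxy (x y : X) : g x y * pushTrace π R ρ x y = ∑ u, ∑ v,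
      if π u = x then if π v = y then if R u v then g x y * ρ u v else 0 else 0 else 0 := by
    simp only [pushTrace_apply, Finset.mul_sum, mul_ite, mul_zero, ite_and]
  simp only [hxy, Finset.sum_comm (s := (Finset.univ : Finset X)) (t := (Finset.univ : Finset U))]
  simp

theorem pushTrace_pushTrace [Fintype X] (π : U → X) (R : U → U → Prop) (π' : X → Y)
    (R' : X → X → Prop) (ρ : Matrix U U ℂ) :
    pushTrace π' R' (pushTrace π R ρ) =
      pushTrace (π' ∘ π) (fun u v => R u v ∧ R' (π u) (π v)) ρ := by
  classical
  ext x y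
  have h := sum_mul_pushTrace π R ρ fun p q => if π' p = x ∧ π' q = y ∧ R' p q then 1 else 0
  simp only [ite_mul, one_mul, zero_mul, ← ite_and] at h
  rw [pushTrace_apply, h, pushTrace_apply]
  simp only [Function.comp_apply, and_left_comm (a := R _ _)]
  congr!

open Classical in
theorem posSemidef_indicator_of_equivalence {U : Type*} [Finite U] {R : U → U → Prop}
    (hR : Equivalence R) :
    (Matrix.of fun u v => if R u v then (1 : ℂ) else 0).PosSemidef := by
  have := Fintype.ofFinite U
  let c : U → Quotient ⟨R, hR⟩ := Quotient.mk _
  have hc (u v : U) : R u v ↔ c u = c v := Quotient.eq (r := ⟨R, hR⟩).symm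
  have hE : (Matrix.of fun u v => if R u v then (1 : ℂ) else 0) =
      (Matrix.of fun u q => if c u = q then (1 : ℂ) else 0) *
        (Matrix.of fun u q => if c u = q then (1 : ℂ) else 0)ᴴ := by
    ext u v
    simp [Matrix.mul_apply, hc, apply_ite, eq_comm]
  exact hE ▸ Matrix.posSemidef_self_mul_conjTranspose _

/-- The sum over the entries with `R u v` is a Hadamard product with a positive semidefinite
matrix, so that the Schur product theorem applies. -/
theorem posSemidef_pushTrace [Finite X] {π : U → X} {R : U → U → Prop} (hR : Equivalence R)
    {ρ : Matrix U U ℂ} (hρ : ρ.PosSemidef) : (pushTrace π R ρ).PosSemidef := by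
  classical
  have hP : pushTrace π R ρ = (Matrix.of fun x u => if π u = x then (1 : ℂ) else 0) *
      ((Matrix.of fun u v => if R u v then (1 : ℂ) else 0) ⊙ ρ) *
        (Matrix.of fun x u => if π u = x then (1 : ℂ) else 0)ᴴ := by
    ext x y
    rw [pushTrace_apply, Finset.sum_comm]
    simp only [Matrix.mul_apply, Matrix.of_apply, Matrix.hadamard_apply,
      Matrix.conjTranspose_apply]
    refine Finset.sum_congr rfl fun v _ => ?_
    by_cases hv : π v = y <;> simp [hv, ← ite_and, and_comm]
  rw [hP]
  exact ((posSemidef_indicator_of_equivalence hR).hadamard hρ).mul_mul_conjTranspose_same _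

theorem amplify_pushTrace (π : U → X) (R : U → U → Prop) (k : ℕ)
    (ρ : Matrix (Fin k × U) (Fin k × U) ℂ) :
    amplify (pushTrace π R) k ρ =
      pushTrace (Prod.map id π) (fun u v : Fin k × U => R u.2 v.2) ρ := by
  ext ⟨a, x⟩ ⟨b, y⟩
  simp only [amplify, Matrix.of_apply, pushTrace_apply, Fintype.sum_prod_type, Prod.map,
    Prod.mk.injEq, id]
  rw [Fintype.sum_eq_single a fun c hc => by simp [hc]]
  refine Finset.sum_congr rfl fun u _ => ?_
  rw [Fintype.sum_eq_single b fun c hc => by simp [hc]]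
  refine Finset.sum_congr rfl fun v _ => ?_
  congr 1
  simp

theorem isCompletelyPositive_pushTrace [Finite X] {R : U → U → Prop}
    (hR : Equivalence R) (π : U → X) :
    IsCompletelyPositive (pushTrace π R) := fun k ρ hρ =>
  amplify_pushTrace π R k ρ ▸ posSemidef_pushTrace (hR.comap Prod.snd) hρ

theorem isTracePreserving_pushTrace [Fintype X] {π : U → X} {R : U → U → Prop}
    (h : ∀ u v, π u = π v ∧ R u v ↔ u = v) : IsTracePreserving (pushTrace π R) := by
  classical
  intro ρ
  have hsum := sum_mul_pushTrace π R ρ fun p q => if p = q then 1 else 0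
  simp only [ite_mul, one_mul, zero_mul, ← ite_and, and_comm (a := R _ _), h] at hsum
  simpa [Matrix.trace] using hsum

theorem IsCompletelyPositive.comp {X Y Z : Type*} {Φ : Matrix Y Y ℂ →ₗ[ℂ] Matrix Z Z ℂ}
    {Ψ : Matrix X X ℂ →ₗ[ℂ] Matrix Y Y ℂ} (hΦ : IsCompletelyPositive Φ)
    (hΨ : IsCompletelyPositive Ψ) : IsCompletelyPositive (Φ ∘ₗ Ψ) :=
  fun k ρ hρ => hΦ k _ (hΨ k ρ hρ)

end PushTrace

section PartialTrace

variable {W : Type*} [Fintype W] [DecidableEq W] {B : W → Type*} [∀ w, Fintype (B w)]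

theorem partialTrace_eq_pushTrace (K : Set W) (ρ : Matrix (∀ w, B w) (∀ w, B w) ℂ) :
    partialTrace K ρ =
      pushTrace (fun u (w : {w // w ∈ K}) => u w) (fun u v => ∀ w ∉ K, u w = v w) ρ := by
  classical
  ext x y
  set e := Equiv.piEquivPiSubtypeProd (· ∈ K) B with he
  have h_kept (a z) : (fun w : {w // w ∈ K} => e.symm (a, z) w) = a :=
    congrArg Prod.fst (e.apply_symm_apply (a, z))
  have h_traced (a z) : (fun w : {w // w ∉ K} => e.symm (a, z) w) = z :=
    congrArg Prod.snd (e.apply_symm_apply (a, z))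
  have h_agree (a z b z') : (∀ w ∉ K, e.symm (a, z) w = e.symm (b, z') w) ↔ z = z' := by
    rw [← h_traced a z, ← h_traced b z', funext_iff]
    simp [h_traced]
  simp only [pushTrace_apply, ← e.symm.sum_comp, Fintype.sum_prod_type, h_kept, h_agree, ite_and]
  simp [partialTrace, he]

/-- The hypotheses say that `π` remembers only wires in `K`, that `R` compares at least the wires
outside of `K`, and that whether `R` holds depends only on the set of wires that agree. -/
theorem pushTrace_eq_of_partialTrace_eq {X : Type*} {K : Set W} {π : (∀ w, B w) → X}
    {R : (∀ w, B w) → (∀ w, B w) → Prop} (hπ : ∀ u v, (∀ w ∈ K, u w = v w) → π u = π v)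
    (hK : ∀ u v, R u v → ∀ w ∉ K, u w = v w)
    (hR : ∀ u v u' v', (∀ w, u w = v w → u' w = v' w) → R u v → R u' v')
    {ρ σ : Matrix (∀ w, B w) (∀ w, B w) ℂ} (h : partialTrace K ρ = partialTrace K σ) :
    pushTrace π R ρ = pushTrace π R σ := by
  classical
  have key (τ : Matrix (∀ w, B w) (∀ w, B w) ℂ) (x y : X) :
      pushTrace π R τ x y = ∑ p, ∑ q,
        (if ∃ u v, (∀ w : {w // w ∈ K}, u w = p w ∧ v w = q w) ∧ π u = x ∧ π v = y ∧ R u v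
          then 1 else 0) * partialTrace K τ p q := by
    rw [partialTrace_eq_pushTrace, sum_mul_pushTrace, pushTrace_apply]
    refine Finset.sum_congr rfl fun u _ => Finset.sum_congr rfl fun v _ => ?_
    have h_iff : (π u = x ∧ π v = y ∧ R u v) ↔ (∀ w ∉ K, u w = v w) ∧ ∃ u' v',
        (∀ w : {w // w ∈ K}, u' w = u w ∧ v' w = v w) ∧ π u' = x ∧ π v' = y ∧ R u' v' := by
      refine ⟨fun ⟨hx, hy, huv⟩ => ⟨hK u v huv, u, v, fun _ => ⟨rfl, rfl⟩, hx, hy, huv⟩, ?_⟩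
      rintro ⟨h_off, u', v', h_on, hx, hy, huv'⟩
      refine ⟨(hπ u u' fun w hw => (h_on ⟨w, hw⟩).1.symm).trans hx,
        (hπ v v' fun w hw => (h_on ⟨w, hw⟩).2.symm).trans hy, hR u' v' u v (fun w hw => ?_) huv'⟩
      by_cases hwK : w ∈ K
      · rw [← (h_on ⟨w, hwK⟩).1, ← (h_on ⟨w, hwK⟩).2, hw]
      · exact h_off w hwK
    simp only [h_iff, ite_and, ite_mul, one_mul, zero_mul]
  ext x y
  rw [key, key, h]

end PartialTrace

/-! ### Adding wires that carry the vacuum -/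

/-- An embedding of the wires `Σ i, P i` into the wires `Σ i, Q i` that respects the agent `i` to
which a wire belongs. -/
abbrev WireEmbedding {I : Type*} (P Q : I → Type*) := ∀ i, P i ↪ Q i

namespace WireEmbedding

variable {I : Type*} {P Q : I → Type*} (J : WireEmbedding P Q) {B : I → Type*}

/-- The action of an embedding on wires. -/
abbrev wire (w : Σ i, P i) : Σ i, Q i := ⟨w.1, J w.1 w.2⟩

theorem wire_injective : Function.Injective J.wire :=
  Function.injective_id.sigma_map fun i => (J i).injective

/-- Restriction of a basis state to the wires in the image of `J`. -/
def restrict (y : ∀ w : Σ i, Q i, Option (B w.1)) (w : Σ i, P i) : Option (B w.1) := y (J.wire w)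

/-- Extension of a basis state by the vacuum on the wires outside of the image of `J`. -/
noncomputable def extend (x : ∀ w : Σ i, P i, Option (B w.1)) (w : Σ i, Q i) : Option (B w.1) :=
  Function.extend (J w.1) (fun p => x ⟨w.1, p⟩) (fun _ => none) w.2

theorem extend_wire (x : ∀ w : Σ i, P i, Option (B w.1)) (w : Σ i, P i) :
    J.extend x (J.wire w) = x w :=
  (J w.1).injective.extend_apply _ _ _

theorem extend_of_notMem_range (x : ∀ w : Σ i, P i, Option (B w.1)) {w : Σ i, Q i}
    (hw : w ∉ Set.range J.wire) : J.extend x w = none :=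
  Function.extend_apply' _ _ _ fun ⟨p, hp⟩ => hw ⟨⟨w.1, p⟩, Sigma.ext rfl (heq_of_eq hp)⟩

theorem restrict_extend (x : ∀ w : Σ i, P i, Option (B w.1)) : J.restrict (J.extend x) = x :=
  funext fun w => J.extend_wire x w

theorem extend_restrict {y : ∀ w : Σ i, Q i, Option (B w.1)}
    (h : ∀ w ∉ Set.range J.wire, y w = none) : J.extend (J.restrict y) = y := by
  funext w
  by_cases hw : w ∈ Set.range J.wire
  · obtain ⟨w, rfl⟩ := hw
    exact J.extend_wire _ w
  · rw [J.extend_of_notMem_range _ hw, h w hw]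

theorem extend_injective : Function.Injective (J.extend (B := B)) :=
  Function.LeftInverse.injective J.restrict_extend

theorem forall_isSome_extend_iff (x : ∀ w : Σ i, P i, Option (B w.1)) (s : (Σ i, Q i) → Bool) :
    (∀ w, (J.extend x w).isSome = s w) ↔
      (∀ w ∉ Set.range J.wire, s w = false) ∧ ∀ w, (x w).isSome = s (J.wire w) := by
  refine ⟨fun h => ⟨fun w hw => ?_, fun w => ?_⟩, fun ⟨h_off, h_on⟩ w => ?_⟩
  · rw [← h w, J.extend_of_notMem_range x hw, Option.isSome_none]
  · rw [← h, J.extend_wire]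
  · by_cases hw : w ∈ Set.range J.wire
    · obtain ⟨w, rfl⟩ := hw
      rw [J.extend_wire, h_on]
    · rw [J.extend_of_notMem_range x hw, h_off w hw, Option.isSome_none]

end WireEmbedding

namespace Positions

variable {A : AgentSpaces.{u}} {T T' : Type*} [PartialOrder T] [PartialOrder T']

theorem answer_injective (L : Positions A T) : Function.Injective L.answer := by
  rintro ⟨i, s⟩ ⟨k, t⟩ h
  simp only [answer, Sigma.mk.injEq] at h
  obtain ⟨rfl, h⟩ := h
  rw [(L.resp i).injective (eq_of_heq h)]

theorem answer_surjective (L : Positions A T) : Function.Surjective L.answer :=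
  fun w => ⟨⟨w.1, (L.resp w.1).symm w.2⟩, by simp [answer]⟩

theorem boxIn_inj (L : Positions A T) {p q : A.Past} {b c : L.AgentOut} :
    L.boxIn p b = L.boxIn q c ↔ p = q ∧ b = c :=
  ⟨fun h => ⟨congrFun h none, funext fun w => congrFun h (some w)⟩, by rintro ⟨rfl, rfl⟩; rfl⟩

theorem boxOut_inj (L : Positions A T) {f g : A.Future} {a c : L.AgentIn} :
    L.boxOut a f = L.boxOut c g ↔ a = c ∧ f = g :=
  ⟨fun h => ⟨funext fun w => congrFun h (some w), congrFun h none⟩, by rintro ⟨rfl, rfl⟩; rfl⟩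

theorem boxOut_eta (L : Positions A T) (x : L.BoxOut) :
    L.boxOut (fun w => x (some w)) (x none) = x := by
  funext w
  cases w <;> rfl

/-- An embedding of the input positions of the agents in `L` into those in `L'`. It need not
respect the order of the positions. -/
abbrev InputEmbedding (L : Positions A T) (L' : Positions A T') :=
  WireEmbedding (fun i => {t // t ∈ L.inp i}) (fun i => {t // t ∈ L'.inp i})

namespace InputEmbedding

variable {L : Positions A T} {L' : Positions A T'} (J : InputEmbedding L L')

/-- The embedding of the output positions under which answers go to answers. -/
def out : WireEmbedding (fun i => {t // t ∈ L.out i}) (fun i => {t // t ∈ L'.out i}) :=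
  fun i => (L.resp i).symm.toEmbedding.trans ((J i).trans (L'.resp i).toEmbedding)

theorem out_resp (i : A.Agent) (t : {t // t ∈ L.inp i}) :
    J.out i (L.resp i t) = L'.resp i (J i t) := by
  simp [out]

theorem out_wire_answer (w : L.InWire) : J.out.wire (L.answer w) = L'.answer (J.wire w) :=
  Sigma.ext rfl (heq_of_eq (J.out_resp w.1 w.2))

theorem extend_out_answer {B : A.Agent → Type*} (b : ∀ w : L.OutWire, Option (B w.1))
    (w : L.InWire) : J.out.extend b (L'.answer (J.wire w)) = b (L.answer w) := by
  simp only [WireEmbedding.extend, answer, ← out_resp]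
  exact (J.out w.1).injective.extend_apply _ _ _

theorem answer_mem_range_iff (w : L'.InWire) :
    L'.answer w ∈ Set.range J.out.wire ↔ w ∈ Set.range J.wire := by
  refine ⟨fun ⟨v, hv⟩ => ?_, fun ⟨v, hv⟩ => ⟨L.answer v, hv ▸ J.out_wire_answer v⟩⟩
  obtain ⟨v, rfl⟩ := L.answer_surjective v
  exact ⟨v, L'.answer_injective ((J.out_wire_answer v).symm.trans hv)⟩

/-- Restriction of the basis states of the larger box input. -/
def restrictIn (y : L'.BoxIn) : L.BoxIn := L.boxIn (y none) (J.out.restrict fun w => y (some w))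

/-- Extension of the basis states of the smaller box output by the vacuum. -/
noncomputable def extendOut (x : L.BoxOut) : L'.BoxOut :=
  L'.boxOut (J.extend fun w => x (some w)) (x none)

/-- Agreement of basis states of the larger box input on all wires that the smaller box lacks. -/
def AgreeOffRange (y z : L'.BoxIn) : Prop := ∀ w ∉ Set.range J.out.wire, y (some w) = z (some w)

theorem equivalence_agreeOffRange : Equivalence J.AgreeOffRange where
  refl _ _ _ := rfl
  symm h w hw := (h w hw).symm
  trans h h' w hw := (h w hw).trans (h' w hw)

theorem restrictIn_boxIn (p : A.Past) (b : L'.AgentOut) :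
    J.restrictIn (L'.boxIn p b) = L.boxIn p (J.out.restrict b) := rfl

theorem extendOut_boxOut (a : L.AgentIn) (f : A.Future) :
    J.extendOut (L.boxOut a f) = L'.boxOut (J.extend a) f := rfl

theorem extendOut_injective : Function.Injective J.extendOut := by
  intro x y h
  obtain ⟨h_agents, h_future⟩ := L'.boxOut_inj.1 h
  rw [← L.boxOut_eta x, ← L.boxOut_eta y, h_future, J.extend_injective h_agents]

theorem restrictIn_eq_and_agreeOffRange_iff (y z : L'.BoxIn) :
    J.restrictIn y = J.restrictIn z ∧ J.AgreeOffRange y z ↔ y = z := by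
  refine ⟨fun ⟨h, h_off⟩ => ?_, by rintro rfl; exact ⟨rfl, fun _ _ => rfl⟩⟩
  obtain ⟨h_past, h_on⟩ := L.boxIn_inj.1 h
  funext w
  rcases w with _ | w
  · exact h_past
  · by_cases hw : w ∈ Set.range J.out.wire
    · obtain ⟨w, rfl⟩ := hw
      exact congrFun h_on w
    · exact h_off w hw

variable [DecidableEq T] [DecidableEq T']

/-- Discard the additional wires to the box. -/
noncomputable def discard : Matrix L'.BoxIn L'.BoxIn ℂ →ₗ[ℂ] Matrix L.BoxIn L.BoxIn ℂ :=
  pushTrace J.restrictIn J.AgreeOffRange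

/-- Send the vacuum on the additional wires from the box. -/
noncomputable def addVacuum : Matrix L.BoxOut L.BoxOut ℂ →ₗ[ℂ] Matrix L'.BoxOut L'.BoxOut ℂ :=
  pushTrace J.extendOut fun _ _ => True

/-- The map `Φ` on the larger set of wires, which ignores the additional ones. -/
noncomputable def extendMap (Φ : Matrix L.BoxIn L.BoxIn ℂ →ₗ[ℂ] Matrix L.BoxOut L.BoxOut ℂ) :
    Matrix L'.BoxIn L'.BoxIn ℂ →ₗ[ℂ] Matrix L'.BoxOut L'.BoxOut ℂ :=
  J.addVacuum ∘ₗ Φ ∘ₗ J.discard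

variable {Φ : Matrix L.BoxIn L.BoxIn ℂ →ₗ[ℂ] Matrix L.BoxOut L.BoxOut ℂ}

theorem isCompletelyPositive_extendMap (hΦ : IsCompletelyPositive Φ) :
    IsCompletelyPositive (J.extendMap Φ) :=
  (isCompletelyPositive_pushTrace ⟨fun _ => trivial, fun _ => trivial, fun _ _ => trivial⟩ _).comp
    (hΦ.comp (isCompletelyPositive_pushTrace J.equivalence_agreeOffRange _))

theorem isTracePreserving_extendMap (hΦ : IsTracePreserving Φ) :
    IsTracePreserving (J.extendMap Φ) := fun ρ =>
  (isTracePreserving_pushTrace (fun _ _ => by rw [and_true, J.extendOut_injective.eq_iff]) _).trans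
    ((hΦ _).trans (isTracePreserving_pushTrace J.restrictIn_eq_and_agreeOffRange_iff ρ))

theorem mem_range_extend_of_extendMap_ne_zero {ρ : Matrix L'.BoxIn L'.BoxIn ℂ} {a c : L'.AgentIn}
    {f g : A.Future} (h : J.extendMap Φ ρ (L'.boxOut a f) (L'.boxOut c g) ≠ 0) :
    a ∈ Set.range (J.extend (B := A.Inp)) ∧ c ∈ Set.range (J.extend (B := A.Inp)) := by
  obtain ⟨⟨x, hx⟩, ⟨y, hy⟩⟩ := mem_range_of_pushTrace_apply_ne_zero h
  exact ⟨⟨_, (L'.boxOut_inj.1 hx).1⟩, ⟨_, (L'.boxOut_inj.1 hy).1⟩⟩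

theorem boxChoi_extendMap_extend (a c : L.AgentIn) (b d : L.AgentOut) (z z' : A.Past × A.Future) :
    L'.boxChoi (J.extendMap Φ) ((J.extend a, J.out.extend b), z)
        ((J.extend c, J.out.extend d), z') = L.boxChoi Φ ((a, b), z) ((c, d), z') := by
  classical
  have h_off : J.AgreeOffRange (L'.boxIn z.1 (J.out.extend b)) (L'.boxIn z'.1 (J.out.extend d)) :=
    fun w hw => (J.out.extend_of_notMem_range b hw).trans (J.out.extend_of_notMem_range d hw).symm
  simp only [boxChoi, choi, Matrix.of_apply, extendMap, LinearMap.comp_apply, discard,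
    pushTrace_single, if_pos h_off, restrictIn_boxIn, WireEmbedding.restrict_extend, addVacuum,
    ← extendOut_boxOut, pushTrace_apply_of_injective J.extendOut_injective, if_true]

/-- The hypothesis holds for agents that answer the vacuum by the vacuum. -/
theorem linkProduct_extendMap
    {X : Matrix (L'.AgentIn × L'.AgentOut) (L'.AgentIn × L'.AgentOut) ℂ}
    (hX : ∀ a b c d, X (J.extend a, b) (J.extend c, d) ≠ 0 →
      ∀ w ∉ Set.range J.out.wire, b w = none ∧ d w = none) :
    linkProduct X (L'.boxChoi (J.extendMap Φ)) =
      linkProduct (X.submatrix (Prod.map J.extend J.out.extend) (Prod.map J.extend J.out.extend))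
        (L.boxChoi Φ) := by
  let ext := Prod.map (J.extend (B := A.Inp)) (J.out.extend (B := A.Out))
  have ext_injective : Function.Injective ext :=
    J.extend_injective.prodMap J.out.extend_injective
  have support {y y' z z'} (h : X y y' * L'.boxChoi (J.extendMap Φ) (y, z) (y', z') ≠ 0) :
      y ∈ Set.range ext ∧ y' ∈ Set.range ext := by
    obtain ⟨a, b⟩ := y
    obtain ⟨c, d⟩ := y'
    obtain ⟨⟨a, rfl⟩, ⟨c, rfl⟩⟩ :=
      J.mem_range_extend_of_extendMap_ne_zero (right_ne_zero_of_mul h)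
    have h_none := hX _ _ _ _ (left_ne_zero_of_mul h)
    exact ⟨⟨(a, J.out.restrict b),
        Prod.ext rfl (J.out.extend_restrict fun w hw => (h_none w hw).1)⟩,
      ⟨(c, J.out.restrict d),
        Prod.ext rfl (J.out.extend_restrict fun w hw => (h_none w hw).2)⟩⟩
  ext z z'
  refine (Fintype.sum_of_injective ext ext_injective _ _ (fun y hy => ?_) fun y => ?_).symm
  · exact Finset.sum_eq_zero fun y' _ => by_contra fun h => hy (support h).1
  · refine Fintype.sum_of_injective ext ext_injective _ _
      (fun y' hy' => by_contra fun h => hy' (support h).2) fun y' => ?_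
    exact congrArg _ (J.boxChoi_extendMap_extend _ _ _ _ z z').symm

end InputEmbedding

end Positions

/-! ### Local operations on the additional wires -/

section LocalOperation

variable {A : AgentSpaces.{u}} {T T' : Type*} [PartialOrder T] [PartialOrder T']

namespace AgentSpaces

/-- The operation that answers the vacuum by the vacuum and any message by one fixed message. -/
noncomputable def constantOperation (A : AgentSpaces.{u}) (i : A.Agent) :
    Matrix (Option (A.Inp i)) (Option (A.Inp i)) ℂ →ₗ[ℂ]
      Matrix (Option (A.Out i)) (Option (A.Out i)) ℂ :=
  pushTrace (Option.map fun _ => Classical.arbitrary (A.Out i)) Eq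

theorem constantOperation_single (A : AgentSpaces.{u}) (i : A.Agent)
    (x x' : Option (A.Inp i)) :
    A.constantOperation i (Matrix.single x x' 1) = if x = x' then
      Matrix.single (x.map fun _ => Classical.arbitrary (A.Out i))
        (x'.map fun _ => Classical.arbitrary (A.Out i)) 1 else 0 := by
  rw [constantOperation, pushTrace_single]
  congr

theorem isTracePreserving_constantOperation (A : AgentSpaces.{u}) (i : A.Agent) :
    IsTracePreserving (A.constantOperation i) :=
  isTracePreserving_pushTrace fun _ _ => ⟨And.right, fun h => ⟨congrArg _ h, h⟩⟩

end AgentSpaces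

namespace LocalOperation

variable {L : Positions A T}

theorem choi_op_vacuum {i : A.Agent} (M : LocalOperation L i) (t : {t // t ∈ L.inp i}) :
    choi (M.op t) (none, none) (none, none) = 1 := by
  rw [choi, Matrix.of_apply, M.localOrder, Matrix.single_apply_same]

theorem eq_none_of_choi_op_vacuum_ne_zero {i : A.Agent} (M : LocalOperation L i)
    (t : {t // t ∈ L.inp i}) {y y' : Option (A.Out i)}
    (h : choi (M.op t) (none, y) (none, y') ≠ 0) : y = none ∧ y' = none := by
  rw [choi, Matrix.of_apply, M.localOrder, Matrix.single_apply] at h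
  exact (ite_ne_right_iff.1 h).1.imp Eq.symm Eq.symm

end LocalOperation

theorem forall_extend {α β γ : Type*} {f : α → β} {g : α → γ} {c : γ} {p : γ → Prop}
    (hg : ∀ a, p (g a)) (hc : p c) (b : β) : p (Function.extend f g (fun _ => c) b) := by
  classical
  rw [Function.extend_def]
  split_ifs
  exacts [hg _, hc]

namespace Positions.InputEmbedding

variable {L : Positions A T} {L' : Positions A T'} (J : InputEmbedding L L')

/-- The operation of an agent on the wires in the image of `J`. -/
def restrictOperation {i : A.Agent} (M : LocalOperation L' i) : LocalOperation L i where
  op t := M.op (J i t)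
  completelyPositive _ := M.completelyPositive _
  traceNonincreasing _ := M.traceNonincreasing _
  localOrder _ := M.localOrder _
  active _ := M.active _

/-- The operation of an agent, extended by a fixed operation on the wires outside of the image
of `J`. -/
noncomputable def extendOperation {i : A.Agent} (M : LocalOperation L i) :
    LocalOperation L' i where
  op := Function.extend (J i) M.op fun _ => A.constantOperation i
  completelyPositive := forall_extend (p := IsCompletelyPositive) M.completelyPositive
    (isCompletelyPositive_pushTrace eq_equivalence _)
  traceNonincreasing := forall_extend (p := IsTraceNonincreasing) M.traceNonincreasing fun ρ _ =>
    (congrArg Complex.re (A.isTracePreserving_constantOperation i ρ)).le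
  localOrder := forall_extend (g := M.op)
    (p := fun Ψ => Ψ (Matrix.single none none 1) = Matrix.single none none 1) M.localOrder
    (by simp [AgentSpaces.constantOperation_single])
  active := forall_extend (g := M.op)
    (p := fun Ψ => ∀ a a' y, Ψ (Matrix.single (some a) (some a') 1) none y = 0 ∧
      Ψ (Matrix.single (some a) (some a') 1) y none = 0) M.active fun a a' y => by
    rw [AgentSpaces.constantOperation_single]
    split_ifs <;> simp

theorem restrictOperation_extendOperation {i : A.Agent} (M : LocalOperation L i) :
    J.restrictOperation (J.extendOperation M) = M := by
  simp only [restrictOperation, extendOperation, (J i).injective.extend_apply]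

theorem agentsChoi_extend_ne_zero {M : ∀ i, LocalOperation L' i} {a c : L.AgentIn}
    {b d : L'.AgentOut} (h : L'.agentsChoi M (J.extend a, b) (J.extend c, d) ≠ 0)
    (w : L'.OutWire) (hw : w ∉ Set.range J.out.wire) : b w = none ∧ d w = none := by
  obtain ⟨w, rfl⟩ := L'.answer_surjective w
  rw [answer_mem_range_iff] at hw
  have h_factor := Finset.prod_ne_zero_iff.1 h w (Finset.mem_univ _)
  dsimp only at h_factor
  rw [J.extend_of_notMem_range _ hw, J.extend_of_notMem_range _ hw] at h_factor
  exact (M w.1).eq_none_of_choi_op_vacuum_ne_zero w.2 h_factor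

theorem agentsChoi_extend (M : ∀ i, LocalOperation L' i) (a c : L.AgentIn) (b d : L.AgentOut) :
    L'.agentsChoi M (J.extend a, J.out.extend b) (J.extend c, J.out.extend d) =
      L.agentsChoi (fun i => J.restrictOperation (M i)) (a, b) (c, d) := by
  refine (Fintype.prod_of_injective J.wire J.wire_injective _ _ (fun w hw => ?_) fun w => ?_).symm
  · have hw_out := mt (J.answer_mem_range_iff w).1 hw
    dsimp only
    rw [J.extend_of_notMem_range _ hw, J.extend_of_notMem_range _ hw,
      J.out.extend_of_notMem_range b hw_out, J.out.extend_of_notMem_range d hw_out]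
    exact (M w.1).choi_op_vacuum w.2
  · dsimp only
    rw [J.extend_wire, J.extend_wire, extend_out_answer, extend_out_answer]
    rfl

theorem hasPattern_extend_iff (s : L'.InWire → Bool) (r : L'.OutWire → Bool) (a : L.AgentIn)
    (b : L.AgentOut) :
    L'.HasPattern s r (J.extend a, J.out.extend b) ↔
      ((∀ w ∉ Set.range J.wire, s w = false) ∧ ∀ w ∉ Set.range J.out.wire, r w = false) ∧
        L.HasPattern (s ∘ J.wire) (r ∘ J.out.wire) (a, b) :=
  ((J.forall_isSome_extend_iff a s).and (J.out.forall_isSome_extend_iff b r)).trans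
    and_and_and_comm

variable [DecidableEq T] [DecidableEq T']
  {Φ : Matrix L.BoxIn L.BoxIn ℂ →ₗ[ℂ] Matrix L.BoxOut L.BoxOut ℂ}

theorem compose_extendMap (M : ∀ i, LocalOperation L' i) :
    L'.compose (J.extendMap Φ) M = L.compose Φ fun i => J.restrictOperation (M i) := by
  rw [compose, J.linkProduct_extendMap fun a b c d h => J.agentsChoi_extend_ne_zero h, compose]
  congr 1
  ext ⟨a, b⟩ ⟨c, d⟩
  exact J.agentsChoi_extend M a c b d

open Classical in
theorem composeBranch_extendMap (M : ∀ i, LocalOperation L' i) (s : L'.InWire → Bool)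
    (r : L'.OutWire → Bool) :
    L'.composeBranch (J.extendMap Φ) M s r =
      if (∀ w ∉ Set.range J.wire, s w = false) ∧ ∀ w ∉ Set.range J.out.wire, r w = false then
        L.composeBranch Φ (fun i => J.restrictOperation (M i)) (s ∘ J.wire) (r ∘ J.out.wire)
      else 0 := by
  rw [composeBranch, J.linkProduct_extendMap fun a b c d h =>
    J.agentsChoi_extend_ne_zero (ite_ne_right_iff.1 h).2]
  split_ifs with h
  · have h_pattern a b := (J.hasPattern_extend_iff s r a b).trans (and_iff_right h)
    rw [composeBranch]
    congr 1
    ext ⟨a, b⟩ ⟨c, d⟩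
    simp only [Matrix.submatrix_apply, Prod.map, Matrix.of_apply, h_pattern, agentsChoi_extend]
  · ext z z'
    simp only [linkProduct, Matrix.submatrix_apply, Prod.map, Matrix.of_apply,
      hasPattern_extend_iff, h, false_and, if_false, zero_mul, Finset.sum_const_zero,
      Matrix.zero_apply]

end Positions.InputEmbedding

end LocalOperation

/-! ### Causality -/

section StrictLower

variable {T : Type*} [PartialOrder T]

/-- The cut of all positions strictly below some position of the cut `C`. It is the largest
causality function on a finite partially ordered set. -/
def strictLower (C : LowerSet T) : LowerSet T where
  carrier := {s | ∃ t ∈ C, s < t}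
  lower' := fun _ _ hle ⟨t, ht, hlt⟩ => ⟨t, ht, hle.trans_lt hlt⟩

theorem mem_strictLower {C : LowerSet T} {s : T} : s ∈ strictLower C ↔ ∃ t ∈ C, s < t := Iff.rfl

theorem strictLower_lt [Finite T] {C : LowerSet T} (hC : C ≠ ⊥) : strictLower C < C := by
  obtain ⟨t, ht⟩ := (C : Set T).toFinite.exists_maximal
    (Set.nonempty_iff_ne_empty.2 fun h => hC (LowerSet.coe_eq_empty.1 h))
  refine lt_of_le_of_ne (fun s ⟨t, ht, hst⟩ => C.lower hst.le ht) fun h => ?_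
  obtain ⟨s, hs, hts⟩ := mem_strictLower.1 (h.symm ▸ ht.prop)
  exact ht.not_gt hs hts

theorem exists_iterate_strictLower_eq_bot [Finite T] (C : LowerSet T) :
    ∃ n : ℕ, strictLower^[n] C = ⊥ := by
  have : Finite (LowerSet T) := Finite.of_injective _ SetLike.coe_injective
  induction C using WellFoundedLT.induction with
  | ind C ih =>
    by_cases hC : C = ⊥
    · exact ⟨0, hC⟩
    · obtain ⟨n, hn⟩ := ih _ (strictLower_lt hC)
      exact ⟨n + 1, hn⟩

theorem isCausalityFunction_strictLower [Finite T] :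
    IsCausalityFunction (strictLower : LowerSet T → LowerSet T) where
  union C D := by
    ext
    simp only [SetLike.mem_coe, LowerSet.mem_sup_iff, mem_strictLower, or_and_right, exists_or]
  mono _ _ h _ := fun ⟨t, ht, hlt⟩ => ⟨t, h ht, hlt⟩
  strict _ _ := strictLower_lt
  exhaust C _ _ _ :=
    (exists_iterate_strictLower_eq_bot C).imp fun _ hn ht => LowerSet.notMem_bot (hn ▸ ht)

theorem IsCausalityFunction.map_Iic_le {χ : LowerSet T → LowerSet T} (hχ : IsCausalityFunction χ)
    (t : T) : χ (LowerSet.Iic t) ≤ strictLower (LowerSet.Iic t) := by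
  have h_lt : χ (LowerSet.Iic t) < LowerSet.Iic t :=
    hχ.strict _ ⟨t, le_rfl⟩ fun h => LowerSet.notMem_bot (h ▸ LowerSet.mem_Iic_iff.2 le_rfl)
  refine fun s hs => ⟨t, LowerSet.mem_Iic_iff.2 le_rfl, lt_of_le_of_ne (h_lt.le hs) ?_⟩
  rintro rfl
  exact h_lt.not_ge (LowerSet.Iic_le.2 hs)

theorem IsCausalityFunction.map_bot {χ : LowerSet T → LowerSet T} (hχ : IsCausalityFunction χ) :
    χ ⊥ = ⊥ := by
  refine eq_bot_iff.2 fun t ht => ?_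
  obtain ⟨n, hn⟩ := hχ.exhaust (LowerSet.Iic t) ⟨t, le_rfl⟩ t (LowerSet.mem_Iic_iff.2 le_rfl)
  cases n with
  | zero => exact hn (LowerSet.mem_Iic_iff.2 le_rfl)
  | succ n =>
    rw [Function.iterate_succ_apply'] at hn
    exact hn (hχ.mono ⊥ _ bot_le ht)

theorem IsCausalityFunction.le_strictLower [Finite T] {χ : LowerSet T → LowerSet T}
    (hχ : IsCausalityFunction χ) (C : LowerSet T) : χ C ≤ strictLower C := by
  have hC : C = (C : Set T).toFinite.toFinset.sup LowerSet.Iic := by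
    refine le_antisymm (fun t ht => ?_) (Finset.sup_le fun t ht => ?_)
    · exact Finset.le_sup (f := LowerSet.Iic) ((Set.Finite.mem_toFinset _).2 ht) le_rfl
    · exact LowerSet.Iic_le.2 ((Set.Finite.mem_toFinset _).1 ht)
  conv_lhs => rw [hC, Finset.apply_sup_eq_sup_comp χ hχ.union hχ.map_bot]
  refine Finset.sup_le fun t ht => (hχ.map_Iic_le t).trans ?_
  exact isCausalityFunction_strictLower.mono _ _
    (LowerSet.Iic_le.2 ((Set.Finite.mem_toFinset _).1 ht))

end StrictLower

namespace Positions

variable {A : AgentSpaces.{u}} {T T' : Type*} [PartialOrder T] [PartialOrder T']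
  {L : Positions A T} {L' : Positions A T'}

/-- The position at which the box receives from a wire. -/
def inPosition (L : Positions A T) (w : Option L.OutWire) : T := w.elim L.past fun w => w.2

/-- The position at which the box sends to a wire. -/
def outPosition (L : Positions A T) (w : Option L.InWire) : T := w.elim L.future fun w => w.2

namespace InputEmbedding

variable (J : InputEmbedding L L')

/-- Whenever the box can receive from a wire before it sends to another wire, it can still do so
after the embedding. -/
def PreservesCausalOrder : Prop :=
  ∀ w w', L.inPosition w < L.outPosition w' →
    L'.inPosition (w.map J.out.wire) < L'.outPosition (w'.map J.wire)

theorem restrictIn_apply_eq_iff (y z : L'.BoxIn) (w : Option L.OutWire) :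
    J.restrictIn y w = J.restrictIn z w ↔ y (w.map J.out.wire) = z (w.map J.out.wire) := by
  cases w <;> rfl

theorem extendOut_apply_eq_iff (x y : L.BoxOut) (w : Option L.InWire) :
    J.extendOut x (w.map J.wire) = J.extendOut y (w.map J.wire) ↔ x w = y w := by
  rcases w with _ | w
  · rfl
  · exact Eq.congr (J.extend_wire (fun w => x (some w)) w) (J.extend_wire (fun w => y (some w)) w)

theorem extendOut_apply_eq_of_notMem_range (x y : L.BoxOut) {w : L'.InWire}
    (hw : w ∉ Set.range J.wire) : J.extendOut x (some w) = J.extendOut y (some w) :=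
  (J.extend_of_notMem_range (fun w => x (some w)) hw).trans
    (J.extend_of_notMem_range (fun w => y (some w)) hw).symm

theorem extendOut_apply_eq_imp {x y x' y' : L.BoxOut} {w : Option L'.InWire}
    (h : ∀ v : Option L.InWire, v.map J.wire = w → x v = y v → x' v = y' v) :
    J.extendOut x w = J.extendOut y w → J.extendOut x' w = J.extendOut y' w := by
  have of_map (v : Option L.InWire) (hv : v.map J.wire = w) :
      J.extendOut x w = J.extendOut y w → J.extendOut x' w = J.extendOut y' w := by
    subst hv
    rw [extendOut_apply_eq_iff, extendOut_apply_eq_iff]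
    exact h v rfl
  rcases w with _ | w
  · exact of_map none rfl
  by_cases hw : w ∈ Set.range J.wire
  · obtain ⟨v, rfl⟩ := hw
    exact of_map (some v) rfl
  · exact fun _ => J.extendOut_apply_eq_of_notMem_range x' y' hw

variable [DecidableEq T] [DecidableEq T']

theorem partialTrace_discard_eq {K : Set (Option L.OutWire)} {K' : Set (Option L'.OutWire)}
    (hK : ∀ w ∈ K, w.map J.out.wire ∈ K') {ρ σ : Matrix L'.BoxIn L'.BoxIn ℂ}
    (h : partialTrace K' ρ = partialTrace K' σ) :
    partialTrace K (J.discard ρ) = partialTrace K (J.discard σ) := by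
  rw [partialTrace_eq_pushTrace, partialTrace_eq_pushTrace, discard, pushTrace_pushTrace,
    pushTrace_pushTrace]
  refine pushTrace_eq_of_partialTrace_eq (fun y z hyz => ?_) (fun y z hyz w hw => ?_)
    (fun y z y' z' h_agree hyz => ?_) h
  · exact funext fun w => (J.restrictIn_apply_eq_iff y z w).2 (hyz _ (hK _ w.2))
  · rcases w with _ | w
    · exact hyz.2 none (mt (hK none) hw)
    by_cases h_range : w ∈ Set.range J.out.wire
    · obtain ⟨w, rfl⟩ := h_range
      exact (J.restrictIn_apply_eq_iff y z (some w)).1 (hyz.2 (some w) (mt (hK _) hw))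
    · exact hyz.1 w h_range
  · exact ⟨fun w hw => h_agree _ (hyz.1 w hw), fun w hw =>
      (J.restrictIn_apply_eq_iff y' z' w).2
        (h_agree _ ((J.restrictIn_apply_eq_iff y z w).1 (hyz.2 w hw)))⟩

theorem partialTrace_addVacuum_eq {K : Set (Option L.InWire)} {K' : Set (Option L'.InWire)}
    (hK : ∀ w, w.map J.wire ∈ K' → w ∈ K) {ρ σ : Matrix L.BoxOut L.BoxOut ℂ}
    (h : partialTrace K ρ = partialTrace K σ) :
    partialTrace K' (J.addVacuum ρ) = partialTrace K' (J.addVacuum σ) := by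
  rw [partialTrace_eq_pushTrace, partialTrace_eq_pushTrace, addVacuum, pushTrace_pushTrace,
    pushTrace_pushTrace]
  refine pushTrace_eq_of_partialTrace_eq (fun y z hyz => ?_) (fun y z hyz w hw => ?_)
    (fun y z y' z' h_agree hyz => ?_) h
  · exact funext fun w =>
      J.extendOut_apply_eq_imp (x := y) (y := y) (fun v hv _ => hyz v (hK v (hv ▸ w.2))) rfl
  · exact (J.extendOut_apply_eq_iff y z w).1 (hyz.2 _ (mt (hK w) hw))
  · exact ⟨trivial, fun w hw => J.extendOut_apply_eq_imp (fun v _ => h_agree v) (hyz.2 w hw)⟩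

theorem causal_extendMap [Finite T] (hJ : J.PreservesCausalOrder)
    {Φ : Matrix L.BoxIn L.BoxIn ℂ →ₗ[ℂ] Matrix L.BoxOut L.BoxOut ℂ}
    {χ : LowerSet T → LowerSet T} (hχ : IsCausalityFunction χ)
    (hΦ : ∀ (C : LowerSet T) (ρ σ : Matrix L.BoxIn L.BoxIn ℂ),
      partialTrace (L.boxInWires (χ C)) ρ = partialTrace (L.boxInWires (χ C)) σ →
      partialTrace (L.boxOutWires C) (Φ ρ) = partialTrace (L.boxOutWires C) (Φ σ))
    (C' : LowerSet T') (ρ σ : Matrix L'.BoxIn L'.BoxIn ℂ)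
    (h : partialTrace (L'.boxInWires (strictLower C')) ρ =
      partialTrace (L'.boxInWires (strictLower C')) σ) :
    partialTrace (L'.boxOutWires C') (J.extendMap Φ ρ) =
      partialTrace (L'.boxOutWires C') (J.extendMap Φ σ) := by
  let C : LowerSet T :=
    { carrier := {t | ∃ w, t ≤ L.outPosition w ∧ L'.outPosition (w.map J.wire) ∈ C'}
      lower' := fun _ _ hle ⟨w, hw, hC'⟩ => ⟨w, hle.trans hw, hC'⟩ }
  have h_out (w : Option L.InWire) (hw : w.map J.wire ∈ L'.boxOutWires C') :
      w ∈ L.boxOutWires C := ⟨w, le_rfl, hw⟩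
  have h_in (w : Option L.OutWire) (hw : w ∈ L.boxInWires (χ C)) :
      w.map J.out.wire ∈ L'.boxInWires (strictLower C') := by
    obtain ⟨t, ⟨w', htw', hw'⟩, hwt⟩ := hχ.le_strictLower C hw
    exact ⟨_, hw', hJ w w' (hwt.trans_le htw')⟩
  exact J.partialTrace_addVacuum_eq h_out (hΦ C _ _ (J.partialTrace_discard_eq h_in h))

end InputEmbedding

end Positions

/-! ### Process boxes with additional wires -/

theorem card_filter_add_ite_le_one {W T : Type*} [Fintype W] [DecidableEq T] {f : W → T}
    {p : W → Prop} [DecidablePred p] (hp : Set.InjOn f {w | p w}) {e : T} (he : ∀ w, f w ≠ e)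
    (t : T) :
    (Finset.univ.filter fun w => f w = t ∧ p w).card + (if t = e then 1 else 0) ≤ 1 := by
  split_ifs with ht
  · simp [ht, he]
  · refine Finset.card_le_one.2 fun w hw w' hw' => ?_
    obtain ⟨-, hwt, hpw⟩ := Finset.mem_filter.1 hw
    obtain ⟨-, hwt', hpw'⟩ := Finset.mem_filter.1 hw'
    exact hp hpw hpw' (hwt.trans hwt'.symm)

namespace Positions

variable {A : AgentSpaces.{u}} {T : Type*} [PartialOrder T]

theorem inWire_ne_future (L : Positions A T) (w : L.InWire) : (w.2 : T) ≠ L.future :=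
  ((L.lt_resp w.1 w.2).trans_le (L.le_future _)).ne

theorem outWire_ne_past (L : Positions A T) (w : L.OutWire) : (w.2 : T) ≠ L.past := by
  obtain ⟨w, rfl⟩ := L.answer_surjective w
  exact ((L.past_le _).trans_lt (L.lt_resp w.1 w.2)).ne'

end Positions

namespace ProcessBox

variable {A : AgentSpaces.{u}} {T T' : Type v} [PartialOrder T] [Fintype T] [DecidableEq T]
  [PartialOrder T'] [Fintype T'] [DecidableEq T'] (Φ : ProcessBox A T) {L' : Positions A T'}
  (J : Positions.InputEmbedding Φ.pos L') (hJ : J.PreservesCausalOrder)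

/-- The process box that acts as `Φ` on the wires in the image of `J`, ignores messages from the
other wires and sends the vacuum to them. -/
noncomputable def extend : ProcessBox A T' where
  pos := L'
  map := J.extendMap Φ.map
  completelyPositive := J.isCompletelyPositive_extendMap Φ.completelyPositive
  tracePreserving := J.isTracePreserving_extendMap Φ.tracePreserving
  causal := by
    obtain ⟨χ, hχ, hΦ⟩ := Φ.causal
    exact ⟨strictLower, isCausalityFunction_strictLower, J.causal_extendMap hJ hχ hΦ⟩
  exactlyOne M s r := by
    rintro ⟨i, hi⟩
    rw [J.composeBranch_extendMap]
    split_ifs with h_off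
    · refine Φ.exactlyOne _ _ _ ⟨i, fun h => hi ?_⟩
      rw [← h, ← Finset.card_map (J i)]
      congr 1
      ext t
      simp only [Finset.mem_filter, Finset.mem_univ, Finset.mem_map, true_and]
      refine ⟨fun ht => ?_, by rintro ⟨t, ht, rfl⟩; exact ht⟩
      by_contra h_none
      have h_notMem : (⟨i, t⟩ : L'.InWire) ∉ Set.range J.wire := by
        rintro ⟨⟨k, u⟩, hu⟩
        obtain ⟨rfl, hu⟩ := Sigma.mk.inj hu
        obtain rfl := eq_of_heq hu
        exact h_none ⟨u, ht, rfl⟩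
      simp [h_off.1 _ h_notMem] at ht
    · rfl

theorem sendsAtMostOne_extend
    (h : Function.Injective fun w : Φ.pos.InWire => ((J.wire w).2 : T')) :
    (Φ.extend J hJ).SendsAtMostOne := by
  intro ρ a f t ht
  by_contra h_ne
  obtain ⟨⟨a, rfl⟩, -⟩ := J.mem_range_extend_of_extendMap_ne_zero h_ne
  refine ht.not_ge (card_filter_add_ite_le_one ?_ L'.inWire_ne_future t)
  have mem_range {w : L'.InWire} (hw : (J.extend a w).isSome = true) : w ∈ Set.range J.wire :=
    by_contra fun h_off => by simp [J.extend_of_notMem_range a h_off] at hw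
  intro w hw w' hw' hww'
  obtain ⟨w, rfl⟩ := mem_range hw
  obtain ⟨w', rfl⟩ := mem_range hw'
  exact congrArg J.wire (h hww')

theorem receivesAtMostOne_extend
    (h : Function.Injective fun w : Φ.pos.OutWire => ((J.out.wire w).2 : T')) :
    (Φ.extend J hJ).ReceivesAtMostOne := by
  intro M s r t ht
  refine (J.composeBranch_extendMap M s r).trans (if_neg fun ⟨_, h_off⟩ => ht.not_ge ?_)
  refine card_filter_add_ite_le_one (p := fun w => r w = true) ?_ L'.outWire_ne_past t
  have mem_range {w : L'.OutWire} (hw : r w = true) : w ∈ Set.range J.out.wire :=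
    by_contra fun hw' => by simp [h_off w hw'] at hw
  intro w hw w' hw' hww'
  obtain ⟨w, rfl⟩ := mem_range hw
  obtain ⟨w', rfl⟩ := mem_range hw'
  exact congrArg J.out.wire (h hww')

theorem operationallyEquivalent_extend : Φ.OperationallyEquivalent (Φ.extend J hJ) := by
  refine ⟨Equiv.refl _, fun _ => J.extendOperation, 1, 1, by simp, by simp, fun M => ?_⟩
  rw [one_kronecker_one, one_mul, conjTranspose_one, mul_one]
  refine (J.compose_extendMap _).trans (congrArg (Φ.pos.compose Φ.map) ?_)
  exact funext fun i => J.restrictOperation_extendOperation (M i)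

end ProcessBox

/-! ### One wire at a time -/

theorem exists_equiv_fin_of_lt {W T : Type*} [Fintype W] [PartialOrder T] (f : W → T) :
    ∃ e : W ≃ Fin (Fintype.card W), ∀ v w, f v < f w → e v < e w := by
  let g := toLinearExtension ∘ f ∘ (Fintype.equivFin W).symm
  refine ⟨(Fintype.equivFin W).trans (Tuple.sort g).symm, fun v w h => ?_⟩
  refine (Tuple.monotone_sort g).reflect_lt ?_
  simpa [g] using lt_of_le_of_ne (toLinearExtension.monotone h.le) h.ne

/-- The values of an embedding of a finite type, numbered by their preimages. -/
noncomputable def equivUnivMap {B T : Type*} [Fintype B] (f : B ↪ T) :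
    B ≃ {t // t ∈ Finset.univ.map f} :=
  (Equiv.subtypeUnivEquiv Finset.mem_univ).symm.trans (Finset.univ.equivMap f)

theorem coe_equivUnivMap {B T : Type*} [Fintype B] (f : B ↪ T) (b : B) :
    (equivUnivMap f b : T) = f b := rfl

/-- The step at which the box sends on the `b`-th wire. -/
def inputStep (k : ℕ) : Fin k ↪ Steps (2 * k + 2) where
  toFun b := ⟨2 * b + 2, Finset.mem_Icc.2 ⟨by lia, by lia⟩⟩
  inj' b c h := by simpa [Fin.ext_iff] using h

/-- The step at which the box receives the answer to its message on the `b`-th wire. -/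
def outputStep (k : ℕ) : Fin k ↪ Steps (2 * k + 2) where
  toFun b := ⟨2 * b + 3, Finset.mem_Icc.2 ⟨by lia, by lia⟩⟩
  inj' b c h := by simpa [Fin.ext_iff] using h

theorem coe_inputStep {k : ℕ} (b : Fin k) : (inputStep k b : ℕ) = 2 * b + 2 := rfl

theorem coe_outputStep {k : ℕ} (b : Fin k) : (outputStep k b : ℕ) = 2 * b + 3 := rfl

theorem inputStep_lt_outputStep {k : ℕ} (b : Fin k) : inputStep k b < outputStep k b :=
  Nat.lt_succ_self (2 * b + 2)

theorem mem_map_inputStep {k : ℕ} {t : Steps (2 * k + 2)} :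
    t ∈ Finset.univ.map (inputStep k) ↔ Even (t : ℕ) ∧ (t : ℕ) < 2 * k + 2 := by
  simp only [Finset.mem_map, Finset.mem_univ, true_and, Subtype.ext_iff, coe_inputStep]
  refine ⟨?_, fun ⟨⟨c, hc⟩, _⟩ => ?_⟩
  · rintro ⟨b, hb⟩
    exact ⟨⟨b + 1, by lia⟩, by lia⟩
  · have := (Finset.mem_Icc.1 t.2).1
    exact ⟨⟨c - 1, by lia⟩, by lia⟩

theorem mem_map_outputStep {k : ℕ} {t : Steps (2 * k + 2)} :
    t ∈ Finset.univ.map (outputStep k) ↔ Odd (t : ℕ) ∧ 1 < (t : ℕ) := by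
  simp only [Finset.mem_map, Finset.mem_univ, true_and, Subtype.ext_iff, coe_outputStep]
  refine ⟨?_, fun ⟨⟨c, hc⟩, _⟩ => ?_⟩
  · rintro ⟨b, hb⟩
    exact ⟨⟨b + 1, by lia⟩, by lia⟩
  · have := (Finset.mem_Icc.1 t.2).2
    exact ⟨⟨c - 1, by lia⟩, by lia⟩

namespace Positions

/-- The positions in simple form at which each agent has `k` inputs and `k` outputs. -/
noncomputable def simple (A : AgentSpaces.{u}) (k : ℕ) : Positions A (Steps (2 * k + 2)) where
  inp _ := Finset.univ.map (inputStep k)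
  out _ := Finset.univ.map (outputStep k)
  resp _ := (equivUnivMap (inputStep k)).symm.trans (equivUnivMap (outputStep k))
  lt_resp _ t := by
    obtain ⟨b, rfl⟩ := (equivUnivMap (inputStep k)).surjective t
    simpa only [Equiv.trans_apply, Equiv.symm_apply_apply, coe_equivUnivMap] using
      inputStep_lt_outputStep b
  past := ⟨1, by simp⟩
  past_le t := (Finset.mem_Icc.1 t.2).1
  future := ⟨2 * k + 2, by simp⟩
  le_future t := (Finset.mem_Icc.1 t.2).2

variable {A : AgentSpaces.{u}} {T : Type*} [PartialOrder T] {L : Positions A T} {k : ℕ}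

theorem simple_resp_equivUnivMap (i : A.Agent) (b : Fin k) :
    ((simple A k).resp i (equivUnivMap (inputStep k) b) : Steps (2 * k + 2)) = outputStep k b :=
  congrArg (outputStep k) ((equivUnivMap (inputStep k)).symm_apply_apply b)

/-- The embedding for which `e` tells when a wire of `L` is used. -/
noncomputable def sequential (e : L.InWire ↪ Fin k) : InputEmbedding L (simple A k) := fun i =>
  (Function.Embedding.sigmaMk i).trans (e.trans (equivUnivMap (inputStep k)).toEmbedding)

theorem coe_sequential_wire (e : L.InWire ↪ Fin k) (w : L.InWire) :
    (((sequential e).wire w).2 : Steps (2 * k + 2)) = inputStep k (e w) :=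
  coe_equivUnivMap _ _

theorem coe_sequential_out_wire_answer (e : L.InWire ↪ Fin k) (w : L.InWire) :
    (((sequential e).out.wire (L.answer w)).2 : Steps (2 * k + 2)) = outputStep k (e w) := by
  rw [InputEmbedding.out_wire_answer]
  exact simple_resp_equivUnivMap w.1 (e w)

theorem preservesCausalOrder_sequential {e : L.InWire ↪ Fin k}
    (he : ∀ v w : L.InWire, (v.2 : T) < w.2 → e v < e w) : (sequential e).PreservesCausalOrder := by
  rintro (_ | w) (_ | v) h
  · exact (by lia : 1 < 2 * k + 2)
  · refine (?_ : 1 < (((sequential e).wire v).2 : ℕ))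
    rw [coe_sequential_wire, coe_inputStep]
    lia
  · obtain ⟨w, rfl⟩ := L.answer_surjective w
    refine (?_ : (((sequential e).out.wire (L.answer w)).2 : ℕ) < 2 * k + 2)
    rw [coe_sequential_out_wire_answer, coe_outputStep]
    lia
  · obtain ⟨w, rfl⟩ := L.answer_surjective w
    refine (?_ : (((sequential e).out.wire (L.answer w)).2 : ℕ) <
      (((sequential e).wire v).2 : ℕ))
    rw [coe_sequential_out_wire_answer, coe_sequential_wire, coe_outputStep, coe_inputStep]
    have := he w v ((L.lt_resp w.1 w.2).trans h)
    lia

theorem injective_coe_sequential_wire (e : L.InWire ↪ Fin k) : Function.Injective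
    fun w : L.InWire => (((sequential e).wire w).2 : Steps (2 * k + 2)) :=
  (inputStep k).injective.comp e.injective

theorem injective_coe_sequential_out_wire (e : L.InWire ↪ Fin k) : Function.Injective
    fun w : L.OutWire => (((sequential e).out.wire w).2 : Steps (2 * k + 2)) := by
  intro v w h
  obtain ⟨v, rfl⟩ := L.answer_surjective v
  obtain ⟨w, rfl⟩ := L.answer_surjective w
  dsimp only at h
  rw [coe_sequential_out_wire_answer, coe_sequential_out_wire_answer] at h
  rw [e.injective ((outputStep k).injective h)]

end Positions

theorem ProcessBox.hasSimpleForm_extend {A : AgentSpaces.{u}} {T : Type} [PartialOrder T]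
    [Fintype T] [DecidableEq T] (Φ : ProcessBox A T) {k : ℕ}
    (J : Positions.InputEmbedding Φ.pos (.simple A k)) (hJ : J.PreservesCausalOrder) :
    (Φ.extend J hJ).HasSimpleForm := by
  refine ⟨(even_two_mul k).add even_two, rfl, rfl, fun i =>
    ⟨fun _ => mem_map_inputStep, fun _ => mem_map_outputStep, fun t => ?_⟩⟩
  obtain ⟨b, rfl⟩ := (equivUnivMap (inputStep k)).surjective t
  refine (congrArg Subtype.val (Positions.simple_resp_equivUnivMap i b)).trans ?_
  rw [coe_equivUnivMap, coe_inputStep, coe_outputStep]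

theorem mainTheorem8_general (A : AgentSpaces.{u}) {T : Type} [PartialOrder T] [Fintype T]
    [DecidableEq T] (Φ : ProcessBox A T) :
    ∃ (m' : ℕ) (Φ' : ProcessBox A (Steps m')),
      Φ'.HasSimpleForm ∧ Φ'.SendsAtMostOne ∧ Φ'.ReceivesAtMostOne ∧
      Φ.OperationallyEquivalent Φ' := by
  obtain ⟨e, he⟩ := exists_equiv_fin_of_lt fun w : Φ.pos.InWire => (w.2 : T)
  let J := Positions.sequential e.toEmbedding
  have hJ : J.PreservesCausalOrder := Positions.preservesCausalOrder_sequential he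
  exact ⟨_, Φ.extend J hJ, Φ.hasSimpleForm_extend J hJ,
    Φ.sendsAtMostOne_extend J hJ (Positions.injective_coe_sequential_wire _),
    Φ.receivesAtMostOne_extend J hJ (Positions.injective_coe_sequential_out_wire _),
    Φ.operationallyEquivalent_extend J hJ⟩

theorem mainTheorem8 (A : AgentSpaces.{u}) (m : ℕ) (Φ : ProcessBox A (Steps m))
    (hΦ : Φ.HasSimpleForm) :
    ∃ (m' : ℕ) (Φ' : ProcessBox A (Steps m')),
      Φ'.HasSimpleForm ∧ Φ'.SendsAtMostOne ∧ Φ'.ReceivesAtMostOne ∧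
      Φ.OperationallyEquivalent Φ' :=
  mainTheorem8_general A Φ
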